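/- Consider $n \ge 1$ agents, a finite set $M$ of indivisible goods and a finite set $D$ of homogeneous divisible goods. Agent $i$ has a utility $u_i(g) \ge 0$ for every good $g \in M \cup D$. A bundle is a pair $(S, x)$ with $S \subseteq M$ and $x \in [0,1]^D$, and $u_i(S,x) = \sum_{g \in S} u_i(g) + \sum_{d \in D} x_d\, u_i(d)$. Utilities are scaled: $\sum_{g \in M \cup D} u_i(g) = 1$ for every agent $i$. An allocation gives each agent $i$ a bundle $A_i = (M_i, x_i)$ such that the sets $M_i$ are pairwise disjoint and $\sum_i x_{i,d} \le 1$ for every $d \in D$ (goods may remain unallocated). Its social welfare is $\mathsf{SW}(\mathcal A) = \sum_i u_i(A_i)$. An allocation is EFM (envy-free for mixed goods) if for all agents $i, j$: if $x_j = 0$, then $u_i(A_i) \ge u_i(A_j)$ or $u_i(A_i) \ge u_i(M_j \setminus \{g\}, x_j)$ for some $g \in M_j$; and if $x_j \ne 0$, then $u_i(A_i) \ge u_i(A_j)$. It is EFXM (envy-free up to any good for mixed goods) if the same holds with "for every $g \in M_j$" in place of "for some $g \in M_j$". For a criterion $P \in \{\mathrm{EFM}, \mathrm{EFXM}\}$,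 let $\mathrm{price}_P(n)$ be the supremum, over all such scaled instances with $n$ agents (and any finite $M$ and $D$), of the ratio of the maximum social welfare over all allocations to the maximum social welfare over all allocations that satisfy $P$. Theorem. $\mathrm{price}_{\mathrm{EFM}}(n) = \Theta(\sqrt n)$ and $\mathrm{price}_{\mathrm{EFXM}}(n) = \Theta(\sqrt n)$. That is, for each $P \in \{\mathrm{EFM}, \mathrm{EFXM}\}$ there are absolute constants $c, C > 0$ such that $c\sqrt n \le \mathrm{price}_P(n) \le C\sqrt n$ for every $n \ge 1$. -/

import Mathlib

namespace MixedGoods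

/-- An instance with `n` agents, `m` indivisible goods and `k` homogeneous divisible goods:
every agent has a non-negative utility for every good. -/
structure Instance (n m k : ℕ) where
  /-- utility of an agent for an indivisible good -/
  uInd : Fin n → Fin m → ℝ
  /-- utility of an agent for the whole of a divisible good -/
  uDiv : Fin n → Fin k → ℝ
  uInd_nonneg : ∀ i g, 0 ≤ uInd i g
  uDiv_nonneg : ∀ i d, 0 ≤ uDiv i d

/-- A feasible, possibly partial, allocation: agent `i` receives the bundle
`(goods i, frac i)`. -/
structure Allocation (n m k : ℕ) where
  /-- the indivisible goods that an agent receives -/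
  goods : Fin n → Finset (Fin m)
  /-- the fraction of each divisible good that an agent receives -/
  frac : Fin n → Fin k → ℝ
  goods_disjoint : ∀ i j, i ≠ j → Disjoint (goods i) (goods j)
  frac_nonneg : ∀ i d, 0 ≤ frac i d
  sum_frac_le_one : ∀ d, ∑ i, frac i d ≤ 1

namespace Instance

variable {n m k : ℕ}

/-- The additive utility of agent `i` for the bundle `(S, x)`. -/
def utility (I : Instance n m k) (i : Fin n) (S : Finset (Fin m)) (x : Fin k → ℝ) : ℝ :=
  ∑ g ∈ S, I.uInd i g + ∑ d, x d * I.uDiv i d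

/-- Utilities are scaled: every agent has utility `1` for all the goods together. -/
def IsScaled (I : Instance n m k) : Prop :=
  ∀ i, I.utility i Finset.univ (fun _ => 1) = 1

/-- The utilitarian social welfare of an allocation. -/
def welfare (I : Instance n m k) (A : Allocation n m k) : ℝ :=
  ∑ i, I.utility i (A.goods i) (A.frac i)

/-- Envy-freeness for mixed goods (EFM). -/
def IsEFM (I : Instance n m k) (A : Allocation n m k) : Prop :=
  ∀ i j : Fin n,
    (A.frac j = 0 →
      I.utility i (A.goods j) (A.frac j) ≤ I.utility i (A.goods i) (A.frac i) ∨
      ∃ g ∈ A.goods j,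
        I.utility i (A.goods j \ {g}) (A.frac j) ≤ I.utility i (A.goods i) (A.frac i)) ∧
    (A.frac j ≠ 0 →
      I.utility i (A.goods j) (A.frac j) ≤ I.utility i (A.goods i) (A.frac i))

/-- Envy-freeness up to any good for mixed goods (EFXM). -/
def IsEFXM (I : Instance n m k) (A : Allocation n m k) : Prop :=
  ∀ i j : Fin n,
    (A.frac j = 0 →
      I.utility i (A.goods j) (A.frac j) ≤ I.utility i (A.goods i) (A.frac i) ∨
      ∀ g ∈ A.goods j,
        I.utility i (A.goods j \ {g}) (A.frac j) ≤ I.utility i (A.goods i) (A.frac i)) ∧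
    (A.frac j ≠ 0 →
      I.utility i (A.goods j) (A.frac j) ≤ I.utility i (A.goods i) (A.frac i))

/-- The maximum social welfare over the allocations that satisfy `P`
(attained for the properties used below, see `isGreatest_maxWelfare_true`,
`isGreatest_maxWelfare_isEFM` and `isGreatest_maxWelfare_isEFXM`). -/
noncomputable def maxWelfare (I : Instance n m k) (P : Allocation n m k → Prop) : ℝ :=
  sSup (I.welfare '' {A | P A})

/-- The optimal social welfare over all allocations. -/
noncomputable def opt (I : Instance n m k) : ℝ :=
  I.maxWelfare fun _ => True

/-- The price of the criterion `P` for the instance `I`, as an extended non-negative real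
(so that a positive number divided by `0` is `∞`). -/
noncomputable def price (I : Instance n m k) (P : Allocation n m k → Prop) : ENNReal :=
  ENNReal.ofReal I.opt / ENNReal.ofReal (I.maxWelfare P)

end Instance

/-- The price of the fairness criterion `P` for `n` agents with scaled utilities: the supremum
of its price over all scaled instances with `n` agents and any numbers of goods. -/
noncomputable def scaledPrice
    (P : ∀ {n m k : ℕ}, Instance n m k → Allocation n m k → Prop) (n : ℕ) : ENNReal :=
  ⨆ (m : ℕ) (k : ℕ) (I : Instance n m k) (_ : I.IsScaled), I.price (P I)

namespace Instance

variable {n m k : ℕ}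

/-- A property of allocations that holds for the empty allocation and is closed in the fractions
of the divisible goods has an allocation of maximum social welfare. -/
theorem isGreatest_maxWelfare (I : Instance n m k) (P : Allocation n m k → Prop)
    (C : (Fin n → Finset (Fin m)) → Set (Fin n → Fin k → ℝ)) (hC : ∀ G, IsClosed (C G))
    (hP : ∀ A : Allocation n m k, P A ↔ A.frac ∈ C A.goods) (h0 : ∃ A, P A) :
    IsGreatest (I.welfare '' {A | P A}) (I.maxWelfare P) := by
  have key : I.welfare '' {A | P A} =
      ⋃ G ∈ {G : Fin n → Finset (Fin m) | ∀ i j, i ≠ j → Disjoint (G i) (G j)},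
        (fun x : Fin n → Fin k → ℝ => ∑ i, I.utility i (G i) (x i)) ''
          (({x | ∀ i d, 0 ≤ x i d} ∩ {x | ∀ d, ∑ i, x i d ≤ 1}) ∩ C G) := by
    ext w
    simp only [Set.mem_image, Set.mem_iUnion, Set.mem_ofPred_eq, Set.mem_inter_iff, exists_prop]
    constructor
    · rintro ⟨A, hA, rfl⟩
      exact ⟨A.goods, A.goods_disjoint, A.frac,
        ⟨⟨A.frac_nonneg, A.sum_frac_le_one⟩, (hP A).1 hA⟩, rfl⟩
    · rintro ⟨G, hG, x, ⟨⟨hx0, hx1⟩, hx⟩, rfl⟩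
      exact ⟨⟨G, x, hG, hx0, hx1⟩, (hP _).2 hx, rfl⟩
  have hcpt : IsCompact (I.welfare '' {A | P A}) := by
    rw [key]
    refine (Set.toFinite _).isCompact_biUnion fun G _ => ?_
    refine IsCompact.image ?_ (by unfold utility; fun_prop)
    refine IsCompact.inter_right ?_ (hC G)
    have hcl : IsClosed ({x : Fin n → Fin k → ℝ | ∀ i d, 0 ≤ x i d} ∩
        {x | ∀ d, ∑ i, x i d ≤ 1}) := by
      refine IsClosed.inter ?_ ?_
      · simp only [Set.ofPred_forall]
        exact isClosed_iInter fun i => isClosed_iInter fun d =>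
          isClosed_le (by fun_prop) (by fun_prop)
      · simp only [Set.ofPred_forall]
        exact isClosed_iInter fun d => isClosed_le (by fun_prop) (by fun_prop)
    refine (isCompact_Icc (a := (0 : Fin n → Fin k → ℝ)) (b := 1)).of_isClosed_subset hcl ?_
    rintro x ⟨hx0, hx1⟩
    refine ⟨fun i d => hx0 i d, fun i d => ?_⟩
    exact (Finset.single_le_sum (fun j _ => hx0 j d) (Finset.mem_univ i)).trans (hx1 d)
  obtain ⟨A, hA⟩ := h0
  exact hcpt.isGreatest_sSup ⟨_, A, hA, rfl⟩

/-- The empty allocation. -/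
def emptyAllocation (n m k : ℕ) : Allocation n m k where
  goods _ := ∅
  frac _ := 0
  goods_disjoint _ _ _ := Finset.disjoint_empty_left _
  frac_nonneg _ _ := le_rfl
  sum_frac_le_one _ := by simp

theorem isGreatest_maxWelfare_true (I : Instance n m k) :
    IsGreatest (Set.range I.welfare) I.opt := by
  have := I.isGreatest_maxWelfare (fun _ => True) (fun _ => Set.univ) (fun _ => isClosed_univ)
    (by simp) ⟨emptyAllocation n m k, trivial⟩
  simpa [opt] using this

theorem isGreatest_maxWelfare_isEFM (I : Instance n m k) :
    IsGreatest (I.welfare '' {A | I.IsEFM A}) (I.maxWelfare I.IsEFM) := by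
  refine I.isGreatest_maxWelfare I.IsEFM
    (fun G => ⋂ i, ⋂ j, {x | I.utility i (G j) (x j) ≤ I.utility i (G i) (x i)} ∪
      ({x | x j = 0} ∩ ⋃ g ∈ G j, {x | I.utility i (G j \ {g}) (x j) ≤ I.utility i (G i) (x i)}))
    (fun G => ?_) (fun A => ?_) ⟨emptyAllocation n m k, fun i j => by simp [emptyAllocation]⟩
  · unfold utility
    refine isClosed_iInter fun i => isClosed_iInter fun j => IsClosed.union
      (isClosed_le (by fun_prop) (by fun_prop)) (IsClosed.inter
        (isClosed_eq (by fun_prop) (by fun_prop)) ?_)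
    exact (G j).finite_toSet.isClosed_biUnion fun g _ => isClosed_le (by fun_prop) (by fun_prop)
  · simp only [IsEFM, Set.mem_iInter, Set.mem_union, Set.mem_inter_iff, Set.mem_ofPred_eq,
      Set.mem_iUnion, exists_prop]
    refine forall_congr' fun i => forall_congr' fun j => ?_
    tauto

theorem isGreatest_maxWelfare_isEFXM (I : Instance n m k) :
    IsGreatest (I.welfare '' {A | I.IsEFXM A}) (I.maxWelfare I.IsEFXM) := by
  refine I.isGreatest_maxWelfare I.IsEFXM
    (fun G => ⋂ i, ⋂ j, {x | I.utility i (G j) (x j) ≤ I.utility i (G i) (x i)} ∪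
      ({x | x j = 0} ∩ ⋂ g ∈ G j, {x | I.utility i (G j \ {g}) (x j) ≤ I.utility i (G i) (x i)}))
    (fun G => ?_) (fun A => ?_) ⟨emptyAllocation n m k, fun i j => by simp [emptyAllocation]⟩
  · unfold utility
    refine isClosed_iInter fun i => isClosed_iInter fun j => IsClosed.union
      (isClosed_le (by fun_prop) (by fun_prop)) (IsClosed.inter
        (isClosed_eq (by fun_prop) (by fun_prop)) ?_)
    exact isClosed_biInter fun g _ => isClosed_le (by fun_prop) (by fun_prop)
  · simp only [IsEFXM, Set.mem_iInter, Set.mem_union, Set.mem_inter_iff, Set.mem_ofPred_eq]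
    refine forall_congr' fun i => forall_congr' fun j => ?_
    tauto

end Instance

end MixedGoods

/-!
Both bounds are proved for a criterion between EFXM and EFM, with constants `1 / 6` and `8`.

*Upper bound, indivisible goods.* Let `o` assign every good to an agent who values it most, and let
`O_k` be the fibre of `o` over `k`. Among the partial EFX allocations whose bundles each lie in one
fibre, take one, `A`, of maximum welfare `V`, and let `v_i` be the value of agent `i` for the own
bundle. Maximality has two consequences. No agent envies the unallocated part of any `O_k`, since
an inclusion-minimal envied subset of it could replace the own bundle of an agent who envies it
(`sum_pool_le`). And every matching of agents to single-good bundles has weight at most `V`, since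
it is itself an EFX allocation (`sum_singleValue_le`). By EFX, a bundle that is not a single good
is worth at most `2 v_i` to agent `i`. Summing the values of all goods over all agents and splitting
the single goods into `n` cyclic matchings gives `V ≥ 1 / 4` (`one_le_four_mul_max`). As every
bundle lies in one fibre, at most `√n` of the fibres `O_i` meet more than `√n` bundles, and these
contribute at most `√n ≤ 4 √n V` to the optimum. Any other `O_i` is worth at most `3 √n v_i` to
agent `i`, plus `√n` times the best single-good bundle in it, and these best bundles form a
matching. Hence the optimum is at most `8 √n V` (`exists_efx_welfare`).

*Upper bound, mixed goods.* Cut every divisible good into `N` equal pieces and treat these as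
indivisible. An EFX allocation of the result is EFXM up to an error of `1 / N` towards the bundles
with a divisible part, because one of its pieces can be removed
(`Instance.IsScaled.exists_almost_efxm`). A limit as `N → ∞`, which exists by compactness, is
exactly EFXM and keeps the welfare bound (`Instance.IsScaled.exists_efxm_welfare`).

*Lower bound.* Take `r = ⌊√n⌋` divisible goods; for `i < r`, agent `i` values only good `i`, and
the others value all goods equally. The optimum is at least `r`. Under EFM, which is
envy-freeness here, the `n - r` equal agents keep every total fraction below about `r / (n - r)`,
so the welfare is at most `3` (`Instance.welfare_hard_le`).
-/

namespace MixedGoods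

/-! ### Partial EFX allocations of indivisible goods -/

section Indivisible

variable {n : ℕ} {G : Type*} {u : Fin n → G → ℝ} {A : Fin n → Finset G}

/-- The value for agent `i` of the bundle of agent `j` if that bundle is a single good, and `0`
otherwise. -/
def singleValue (u : Fin n → G → ℝ) (A : Fin n → Finset G) (i j : Fin n) : ℝ :=
  if (A j).card = 1 then ∑ g ∈ A j, u i g else 0

theorem singleValue_nonneg (hu : ∀ i g, 0 ≤ u i g) (i j : Fin n) :
    0 ≤ singleValue u A i j := by
  unfold singleValue
  split_ifs
  exacts [Finset.sum_nonneg fun g _ => hu i g, le_rfl]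

variable [DecidableEq G]

/-- `A` is a partial EFX allocation of indivisible goods with utilities `u` in which every bundle
lies in one fibre of the assignment `o`. -/
structure IsFiberEFX (u : Fin n → G → ℝ) (o : G → Fin n) (A : Fin n → Finset G) : Prop where
  disjoint : ∀ i j, i ≠ j → Disjoint (A i) (A j)
  fiber : ∀ j, ∀ g ∈ A j, ∀ h ∈ A j, o g = o h
  efx : ∀ i j, ∀ g ∈ A j, ∑ h ∈ (A j).erase g, u i h ≤ ∑ h ∈ A i, u i h

variable {o : G → Fin n}

theorem exists_isFiberEFX_max [Fintype G] (u : Fin n → G → ℝ) (o : G → Fin n) :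
    ∃ A, IsFiberEFX u o A ∧
      ∀ B, IsFiberEFX u o B → ∑ i, ∑ g ∈ B i, u i g ≤ ∑ i, ∑ g ∈ A i, u i g := by
  obtain ⟨A, hA, h⟩ := Set.exists_max_image {A | IsFiberEFX u o A}
    (fun A => ∑ i, ∑ g ∈ A i, u i g) (Set.toFinite _)
    ⟨fun _ => ∅, ⟨by simp, by simp, by simp⟩⟩
  exact ⟨A, hA, h⟩

/-- Removing either of two goods shows that EFX bounds a bundle that is not a single good by
twice the own value. -/
theorem IsFiberEFX.sum_le_two_mul_add (hu : ∀ i g, 0 ≤ u i g) (hA : IsFiberEFX u o A)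
    (i j : Fin n) :
    ∑ g ∈ A j, u i g ≤ 2 * ∑ g ∈ A i, u i g + singleValue u A i j := by
  have hv : 0 ≤ ∑ g ∈ A i, u i g := Finset.sum_nonneg fun g _ => hu i g
  unfold singleValue
  split_ifs with h1
  · linarith
  rcases Finset.eq_empty_or_nonempty (A j) with h0 | h0
  · rw [h0, Finset.sum_empty]; linarith
  obtain ⟨g, hg, h, hh, hne⟩ := Finset.one_lt_card.1
    (lt_of_le_of_ne h0.card_pos (Ne.symm h1))
  have e1 := hA.efx i j g hg
  have e2 := hA.efx i j h hh
  have s1 := Finset.add_sum_erase (A j) (u i) hg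
  have s2 : u i g ≤ ∑ x ∈ (A j).erase h, u i x :=
    Finset.single_le_sum (f := u i) (fun x _ => hu i x) (Finset.mem_erase.2 ⟨hne, hg⟩)
  linarith

/-- Handing the single-good bundles out along a matching is an EFX allocation, so its welfare is
at most the maximum. -/
theorem sum_singleValue_le (hu : ∀ i g, 0 ≤ u i g) (hA : IsFiberEFX u o A)
    (hmax : ∀ B, IsFiberEFX u o B → ∑ i, ∑ g ∈ B i, u i g ≤ ∑ i, ∑ g ∈ A i, u i g)
    (T : Finset (Fin n)) (σ : Fin n → Fin n) (hσ : Set.InjOn σ T) :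
    ∑ i ∈ T, singleValue u A i (σ i) ≤ ∑ i, ∑ g ∈ A i, u i g := by
  classical
  let B : Fin n → Finset G := fun i => if i ∈ T ∧ (A (σ i)).card = 1 then A (σ i) else ∅
  have hB1 : ∀ i, (B i).card ≤ 1 := by
    intro i
    simp only [B]
    split_ifs with h
    exacts [h.2.le, by simp]
  have hB : IsFiberEFX u o B := by
    refine ⟨fun i j hij => ?_, fun j g hg h hh => ?_, fun i j g hg => ?_⟩
    · simp only [B]
      split_ifs with h1 h2
      · exact hA.disjoint _ _ fun h => hij (hσ h1.1 h2.1 h)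
      all_goals simp
    · rw [Finset.card_le_one.1 (hB1 j) g hg h hh]
    · have : (B j).erase g = ∅ := by
        rw [← Finset.card_eq_zero, Finset.card_erase_of_mem hg]
        have := hB1 j
        omega
      rw [this, Finset.sum_empty]
      exact Finset.sum_nonneg fun g _ => hu i g
  refine le_trans (le_of_eq ?_) (hmax B hB)
  rw [← Finset.sum_subset (Finset.subset_univ T)]
  · refine Finset.sum_congr rfl fun i hi => ?_
    simp only [B, singleValue, hi, true_and]
    split_ifs <;> simp
  · intro i _ hi
    simp [B, hi]

/-- The set of unallocated goods in a fibre of `o` is not envied under maximum welfare: an agent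
who envies it could take an inclusion-minimal envied subset instead of the own bundle. -/
theorem sum_pool_le [Fintype G] (hA : IsFiberEFX u o A)
    (hmax : ∀ B, IsFiberEFX u o B → ∑ i, ∑ g ∈ B i, u i g ≤ ∑ i, ∑ g ∈ A i, u i g)
    (i k : Fin n) :
    ∑ g with o g = k ∧ ∀ j, g ∉ A j, u i g ≤ ∑ g ∈ A i, u i g := by
  classical
  by_contra! hlt
  obtain ⟨Z, -, hZ⟩ := Finite.exists_le_minimal
    (p := fun Z : Finset G => Z ⊆ ({g | o g = k ∧ ∀ j, g ∉ A j} : Finset G) ∧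
      ∃ i, ∑ g ∈ A i, u i g < ∑ g ∈ Z, u i g) ⟨subset_rfl, i, hlt⟩
  obtain ⟨hZP, a, ha⟩ := hZ.prop
  have hmem : ∀ g ∈ Z, o g = k ∧ ∀ j, g ∉ A j := fun g hg => by simpa using hZP hg
  have hdis : ∀ j, Disjoint Z (A j) := fun j =>
    Finset.disjoint_left.2 fun g hg => (hmem g hg).2 j
  have hZmin : ∀ g ∈ Z, ∀ j, ∑ h ∈ Z.erase g, u j h ≤ ∑ h ∈ A j, u j h := by
    intro g hg j
    by_contra! h
    exact Finset.notMem_erase g Z (hZ.le_of_le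
      ⟨(Finset.erase_subset g Z).trans hZP, j, h⟩ (Finset.erase_subset g Z) hg)
  have hge : ∀ j, ∑ h ∈ A j, u j h ≤ ∑ h ∈ Function.update A a Z j, u j h := by
    intro j
    rcases eq_or_ne j a with rfl | hj
    · simpa using ha.le
    · simp [hj]
  have hB : IsFiberEFX u o (Function.update A a Z) := by
    refine ⟨fun i j hij => ?_, fun j => ?_, fun i j g hg => ?_⟩
    · rcases eq_or_ne i a with rfl | hi
      · simpa [hij.symm] using hdis j
      · rcases eq_or_ne j a with rfl | hj
        · simpa [hi] using (hdis i).symm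
        · simpa [hi, hj] using hA.disjoint i j hij
    · rcases eq_or_ne j a with rfl | hj
      · simp only [Function.update_self]
        exact fun g hg h hh => (hmem g hg).1.trans (hmem h hh).1.symm
      · simpa [hj] using hA.fiber j
    · refine le_trans ?_ (hge i)
      rcases eq_or_ne j a with rfl | hj
      · simp only [Function.update_self] at hg ⊢
        exact hZmin g hg i
      · simp only [ne_eq, hj, not_false_eq_true, Function.update_of_ne] at hg ⊢
        exact hA.efx i j g hg
  refine absurd (hmax _ hB) (not_le.2 ?_)
  exact Finset.sum_lt_sum (fun j _ => hge j) ⟨a, Finset.mem_univ a, by simpa using ha⟩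

theorem sum_eq_sum_pool_add_sum [Fintype G]
    (hd : ∀ i j, i ≠ j → Disjoint (A i) (A j)) (S : Finset G) (f : G → ℝ) :
    ∑ g ∈ S, f g = ∑ g ∈ S with ∀ j, g ∉ A j, f g + ∑ j, ∑ g ∈ S with g ∈ A j, f g := by
  classical
  rw [← Finset.sum_filter_add_sum_filter_not S (fun g => ∀ j, g ∉ A j)]
  congr 1
  rw [← Finset.sum_biUnion]
  · refine Finset.sum_congr ?_ fun _ _ => rfl
    ext g
    simp
  · intro i _ j _ hij
    exact Finset.disjoint_left.2 fun g hg hg' => Finset.disjoint_left.1 (hd i j hij)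
      (Finset.mem_filter.1 hg).2 (Finset.mem_filter.1 hg').2

/-- With scaled utilities the maximum welfare is at least `1 / 4`. The single-good bundles are
accounted for by splitting all pairs of agents into `n` cyclic matchings. -/
theorem one_le_four_mul_max [Fintype G] [NeZero n] (hu : ∀ i g, 0 ≤ u i g)
    (hscaled : ∀ i, ∑ g, u i g = 1) (hA : IsFiberEFX u o A)
    (hmax : ∀ B, IsFiberEFX u o B → ∑ i, ∑ g ∈ B i, u i g ≤ ∑ i, ∑ g ∈ A i, u i g) :
    1 ≤ 4 * ∑ i, ∑ g ∈ A i, u i g := by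
  classical
  set v : Fin n → ℝ := fun i => ∑ g ∈ A i, u i g with hv
  have key : ∀ i, 1 ≤ 3 * n * v i + ∑ j, singleValue u A i j := by
    intro i
    have h1 : ∑ g with ∀ j, g ∉ A j, u i g ≤ n * v i := by
      rw [← Finset.sum_fiberwise _ o]
      calc _ ≤ ∑ k : Fin n, v i := Finset.sum_le_sum fun k _ => by
            rw [Finset.filter_filter]
            simpa only [and_comm] using sum_pool_le hA hmax i k
        _ = _ := by simp
    have h2 : ∑ j, ∑ g with g ∈ A j, u i g ≤ ∑ j, (2 * v i + singleValue u A i j) :=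
      Finset.sum_le_sum fun j _ => by
        simpa [Finset.filter_mem_eq_inter] using hA.sum_le_two_mul_add hu i j
    have h3 := sum_eq_sum_pool_add_sum hA.disjoint Finset.univ (u i)
    rw [Finset.sum_add_distrib, Finset.sum_const, Finset.card_univ, Fintype.card_fin,
      nsmul_eq_mul] at h2
    rw [hscaled i] at h3
    linarith
  have hS : ∑ i, ∑ j, singleValue u A i j ≤ n * ∑ i, v i := by
    have : ∑ i, ∑ j, singleValue u A i j = ∑ t, ∑ i, singleValue u A i (i + t) := by
      conv_rhs => rw [Finset.sum_comm]
      exact Finset.sum_congr rfl fun i _ => (Equiv.sum_comp (Equiv.addLeft i) _).symm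
    rw [this]
    calc _ ≤ ∑ _t : Fin n, ∑ i, v i := Finset.sum_le_sum fun t _ =>
          sum_singleValue_le hu hA hmax Finset.univ (· + t) (add_left_injective t).injOn
      _ = _ := by simp
  have hsum := Finset.sum_le_sum fun i (_ : i ∈ Finset.univ) => key i
  rw [Finset.sum_add_distrib, ← Finset.mul_sum] at hsum
  simp only [Finset.sum_const, Finset.card_univ, Fintype.card_fin, nsmul_eq_mul, mul_one] at hsum
  have hn : (0 : ℝ) < n := by exact_mod_cast Nat.pos_of_ne_zero (NeZero.ne n)
  have : (n : ℝ) * 1 ≤ n * (4 * ∑ i, v i) := by linarith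
  exact le_of_mul_le_mul_left this hn

/-- A partial EFX allocation whose welfare is within a factor `8 √n` of that of the
assignment `o`. -/
theorem exists_efx_welfare [Fintype G] [NeZero n] (hu : ∀ i g, 0 ≤ u i g)
    (hscaled : ∀ i, ∑ g, u i g = 1) (o : G → Fin n) :
    ∃ A : Fin n → Finset G, (∀ i j, i ≠ j → Disjoint (A i) (A j)) ∧
      (∀ i j, ∀ g ∈ A j, ∑ h ∈ (A j).erase g, u i h ≤ ∑ h ∈ A i, u i h) ∧
      ∑ g, u (o g) g ≤ 8 * √n * ∑ i, ∑ g ∈ A i, u i g := by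
  classical
  obtain ⟨A, hA, hmax⟩ := exists_isFiberEFX_max u o
  refine ⟨A, hA.disjoint, hA.efx, ?_⟩
  have hV := one_le_four_mul_max hu hscaled hA hmax
  set v : Fin n → ℝ := fun i => ∑ g ∈ A i, u i g with hv
  have hv0 : ∀ i, 0 ≤ v i := fun i => Finset.sum_nonneg fun g _ => hu i g
  have hs1 : 1 ≤ √(n : ℝ) := by
    rw [Real.one_le_sqrt]
    exact_mod_cast Nat.one_le_iff_ne_zero.2 (NeZero.ne n)
  -- the agents whose bundles were cut out of the fibre of `i`
  let J : Fin n → Finset (Fin n) := fun i => {j | ∃ g ∈ A j, o g = i}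
  have hJ : ∀ i i' j, j ∈ J i → j ∈ J i' → i = i' := by
    intro i i' j h h'
    obtain ⟨g, hg, rfl⟩ : ∃ g ∈ A j, o g = i := by simpa [J] using h
    obtain ⟨g', hg', rfl⟩ : ∃ g ∈ A j, o g = i' := by simpa [J] using h'
    exact hA.fiber j g hg g' hg'
  let H : Finset (Fin n) := {i | √n < (J i).card}
  have hH : (H.card : ℝ) ≤ √n := by
    have h1 : ∑ i ∈ H, (J i).card ≤ n := by
      rw [← Finset.card_biUnion]
      · simpa using Finset.card_le_univ (H.biUnion J)
      · exact fun i _ i' _ hne => Finset.disjoint_left.2 fun j h h' => hne (hJ i i' j h h')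
    have h2 : H.card * √n ≤ n := by
      calc H.card * √n = ∑ i ∈ H, √(n : ℝ) := by simp
        _ ≤ ∑ i ∈ H, ((J i).card : ℝ) :=
          Finset.sum_le_sum fun i hi => (Finset.mem_filter.1 hi).2.le
        _ ≤ n := by exact_mod_cast h1
    have h3 : √(n : ℝ) * √n = n := Real.mul_self_sqrt (Nat.cast_nonneg n)
    exact le_of_mul_le_mul_right (h2.trans h3.ge) (by linarith)
  have hm : ∀ i, ∃ j, (J i).Nonempty →
      j ∈ J i ∧ ∀ l ∈ J i, singleValue u A i l ≤ singleValue u A i j := by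
    intro i
    by_cases h : (J i).Nonempty
    · obtain ⟨j, hj⟩ := Finset.exists_max_image (J i) (singleValue u A i) h
      exact ⟨j, fun _ => hj⟩
    · exact ⟨i, fun h' => absurd h' h⟩
  choose μ hμ using hm
  let T : Finset (Fin n) := {i | (J i).Nonempty}
  have hμV : ∑ i ∈ T, singleValue u A i (μ i) ≤ ∑ i, v i := by
    refine sum_singleValue_le hu hA hmax T μ fun i hi i' hi' h => ?_
    have h1 := (hμ i (by simpa [T] using hi)).1
    have h2 := (hμ i' (by simpa [T] using hi')).1
    rw [h] at h1
    exact hJ _ _ _ h1 h2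
  -- an agent whose fibre meets few bundles finds most of it either in the pool, in bundles worth
  -- at most `2 * v i`, or in at most `√n` single goods
  have hbound : ∀ i, ∑ g with o g = i, u i g ≤ (if i ∈ H then 1 else 0) + 3 * √n * v i +
      √n * (if i ∈ T then singleValue u A i (μ i) else 0) := by
    intro i
    have hs : 0 ≤ √n * (if i ∈ T then singleValue u A i (μ i) else 0) := by
      refine mul_nonneg (by linarith) ?_
      split_ifs
      exacts [singleValue_nonneg hu _ _, le_rfl]
    by_cases hi : i ∈ H
    · have h1 : ∑ g with o g = i, u i g ≤ 1 := by
        rw [← hscaled i]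
        exact Finset.sum_le_sum_of_subset_of_nonneg (Finset.filter_subset _ _)
          fun g _ _ => hu i g
      have : 0 ≤ 3 * √n * v i := mul_nonneg (by linarith) (hv0 i)
      rw [if_pos hi]
      linarith
    · have hcard : ((J i).card : ℝ) ≤ √n := by simpa [H] using hi
      rw [if_neg hi, sum_eq_sum_pool_add_sum hA.disjoint, Finset.filter_filter]
      have hp := sum_pool_le hA hmax i i
      have hJsum : ∑ j, ∑ g ∈ {g | o g = i} with g ∈ A j, u i g ≤
          ∑ j ∈ J i, (2 * v i + (if i ∈ T then singleValue u A i (μ i) else 0)) := by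
        rw [← Finset.sum_subset (Finset.subset_univ (J i))]
        · refine Finset.sum_le_sum fun j hj => ?_
          have hT : (J i).Nonempty := ⟨j, hj⟩
          rw [if_pos (by simpa [T] using hT)]
          have h1 := (hμ i hT).2 j hj
          have h2 := hA.sum_le_two_mul_add hu i j
          have h3 : ∑ g ∈ {g | o g = i} with g ∈ A j, u i g ≤ ∑ g ∈ A j, u i g :=
            Finset.sum_le_sum_of_subset_of_nonneg (fun g hg => (Finset.mem_filter.1 hg).2)
              fun g _ _ => hu i g
          linarith
        · intro j _ hj
          refine Finset.sum_eq_zero fun g hg => absurd ?_ hj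
          simp only [Finset.mem_filter, Finset.mem_univ, true_and] at hg
          simpa [J] using ⟨g, hg.2, hg.1⟩
      rw [Finset.sum_const, nsmul_eq_mul] at hJsum
      have h4 : ((J i).card : ℝ) * (2 * v i + (if i ∈ T then singleValue u A i (μ i) else 0)) ≤
          √n * (2 * v i + (if i ∈ T then singleValue u A i (μ i) else 0)) := by
        refine mul_le_mul_of_nonneg_right hcard (add_nonneg (by linarith [hv0 i]) ?_)
        split_ifs
        exacts [singleValue_nonneg hu _ _, le_rfl]
      have h5 : v i ≤ √n * v i := le_mul_of_one_le_left (hv0 i) hs1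
      linarith
  have htot : ∑ g, u (o g) g ≤ √n + 3 * √n * ∑ i, v i + √n * ∑ i, v i := by
    calc ∑ g, u (o g) g = ∑ i, ∑ g with o g = i, u i g := by
          rw [← Finset.sum_fiberwise _ o]
          exact Finset.sum_congr rfl fun i _ => Finset.sum_congr rfl fun g hg => by
            rw [(Finset.mem_filter.1 hg).2]
      _ ≤ _ := Finset.sum_le_sum fun i _ => hbound i
      _ = (H.card : ℝ) + 3 * √n * ∑ i, v i + √n * ∑ i ∈ T, singleValue u A i (μ i) := by
          rw [Finset.sum_add_distrib, Finset.sum_add_distrib, ← Finset.mul_sum,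
            ← Finset.mul_sum, Finset.sum_ite_mem, Finset.sum_ite_mem]
          simp
      _ ≤ _ := by gcongr
  have : √n * 1 ≤ √n * (4 * ∑ i, v i) := by gcongr
  linarith

end Indivisible

namespace Instance

variable {n m k : ℕ}

/-! ### Basic facts on mixed instances -/

theorem IsEFXM.isEFM {I : Instance n m k} {A : Allocation n m k} (h : I.IsEFXM A) :
    I.IsEFM A := by
  refine fun i j => ⟨fun hj => ?_, (h i j).2⟩
  rcases Finset.eq_empty_or_nonempty (A.goods j) with h0 | ⟨g, hg⟩
  · left
    rw [h0, hj]
    simpa [utility] using add_nonneg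
      (Finset.sum_nonneg fun g (_ : g ∈ A.goods i) => I.uInd_nonneg i g)
      (Finset.sum_nonneg fun d (_ : d ∈ Finset.univ) =>
        mul_nonneg (A.frac_nonneg i d) (I.uDiv_nonneg i d))
  · exact ((h i j).1 hj).imp id fun h' => ⟨g, hg, h' g hg⟩

theorem IsScaled.uDiv_le_one {I : Instance n m k} (hI : I.IsScaled) (i : Fin n) (d : Fin k) :
    I.uDiv i d ≤ 1 := by
  rw [← hI i, utility]
  have h1 := Finset.single_le_sum (f := I.uDiv i) (fun d _ => I.uDiv_nonneg i d)
    (Finset.mem_univ d)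
  have h2 := Finset.sum_nonneg fun g (_ : g ∈ Finset.univ) => I.uInd_nonneg i g
  simp only [one_mul]
  linarith

/-- If `a` and `b` name an agent with the highest utility for each good, no allocation has more
welfare than giving every good to that agent. -/
theorem welfare_le_sum_max (I : Instance n m k) (a : Fin m → Fin n) (b : Fin k → Fin n)
    (ha : ∀ i g, I.uInd i g ≤ I.uInd (a g) g) (hb : ∀ i d, I.uDiv i d ≤ I.uDiv (b d) d)
    (A : Allocation n m k) :
    I.welfare A ≤ ∑ g, I.uInd (a g) g + ∑ d, I.uDiv (b d) d := by
  classical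
  unfold welfare utility
  rw [Finset.sum_add_distrib]
  refine add_le_add ?_ ?_
  · calc ∑ i, ∑ g ∈ A.goods i, I.uInd i g ≤ ∑ i, ∑ g ∈ A.goods i, I.uInd (a g) g :=
          Finset.sum_le_sum fun i _ => Finset.sum_le_sum fun g _ => ha i g
      _ = ∑ g ∈ Finset.univ.biUnion A.goods, I.uInd (a g) g := by
          rw [Finset.sum_biUnion]
          exact fun i _ j _ hij => A.goods_disjoint i j hij
      _ ≤ _ := Finset.sum_le_sum_of_subset_of_nonneg (Finset.subset_univ _)
          fun g _ _ => I.uInd_nonneg _ g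
  · rw [Finset.sum_comm]
    refine Finset.sum_le_sum fun d _ => ?_
    calc ∑ i, A.frac i d * I.uDiv i d ≤ ∑ i, A.frac i d * I.uDiv (b d) d :=
          Finset.sum_le_sum fun i _ => mul_le_mul_of_nonneg_left (hb i d) (A.frac_nonneg i d)
      _ = (∑ i, A.frac i d) * I.uDiv (b d) d := by rw [Finset.sum_mul]
      _ ≤ _ := mul_le_of_le_one_left (I.uDiv_nonneg _ d) (A.sum_frac_le_one d)

/-! ### From indivisible to mixed goods by cutting and a limit -/

/-- The utilities after cutting every divisible good into `N` equal pieces, which become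
indivisible goods. -/
noncomputable def cutUtility (I : Instance n m k) (N : ℕ) (i : Fin n) : Fin m ⊕ Fin k × Fin N → ℝ :=
  Sum.elim (I.uInd i) fun p => I.uDiv i p.1 / N

/-- The fraction of the divisible good `d` that the pieces in `S` make up. -/
noncomputable def pieceFrac (N : ℕ) (S : Finset (Fin m ⊕ Fin k × Fin N)) (d : Fin k) : ℝ :=
  ((Finset.univ.filter fun p : Fin N => Sum.inr (d, p) ∈ S).card : ℝ) / N

theorem sum_cutUtility (I : Instance n m k) (N : ℕ) (i : Fin n)
    (S : Finset (Fin m ⊕ Fin k × Fin N)) :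
    ∑ h ∈ S, I.cutUtility N i h =
      I.utility i (Finset.univ.filter fun g => Sum.inl g ∈ S) (pieceFrac N S) := by
  classical
  have : ∑ h ∈ S, I.cutUtility N i h = ∑ h, if h ∈ S then I.cutUtility N i h else 0 := by simp
  rw [this, Fintype.sum_sum_type, Fintype.sum_prod_type, utility, Finset.sum_filter]
  congr 1
  refine Finset.sum_congr rfl fun d _ => ?_
  rw [← Finset.sum_filter]
  simp only [cutUtility, Sum.elim_inr, Finset.sum_const, nsmul_eq_mul, pieceFrac]
  ring

/-- Cutting the divisible goods into `N` pieces and using EFX for indivisible goods gives an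
allocation that is EFXM up to an error of `1 / N` towards the bundles with a divisible part. -/
theorem IsScaled.exists_almost_efxm [NeZero n] {I : Instance n m k} (hI : I.IsScaled)
    (N : ℕ) [NeZero N] :
    ∃ A : Allocation n m k,
      (∀ i j, ∀ g ∈ A.goods j, I.utility i (A.goods j \ {g}) (A.frac j) ≤
        I.utility i (A.goods i) (A.frac i)) ∧
      (∀ i j, A.frac j ≠ 0 → I.utility i (A.goods j) (A.frac j) ≤
        I.utility i (A.goods i) (A.frac i) + 1 / N) ∧
      ∀ B, I.welfare B ≤ 8 * √n * I.welfare A := by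
  classical
  have hN : (0 : ℝ) < N := by exact_mod_cast Nat.pos_of_ne_zero (NeZero.ne N)
  have hu : ∀ i h, 0 ≤ I.cutUtility N i h := by
    rintro i (g | p)
    exacts [I.uInd_nonneg i g, div_nonneg (I.uDiv_nonneg i _) hN.le]
  have hscaled : ∀ i, ∑ h, I.cutUtility N i h = 1 := by
    intro i
    rw [sum_cutUtility, ← hI i]
    congr 1
    · simp
    · ext d
      simp [pieceFrac, hN.ne']
  have ha : ∀ g, ∃ a, ∀ i, I.uInd i g ≤ I.uInd a g := fun g => Finite.exists_max _
  have hb : ∀ d, ∃ b, ∀ i, I.uDiv i d ≤ I.uDiv b d := fun d => Finite.exists_max _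
  choose a ha using ha
  choose b hb using hb
  obtain ⟨A, hdis, hefx, hw⟩ := exists_efx_welfare hu hscaled
    (Sum.elim a fun p => b p.1)
  let A' : Allocation n m k :=
    { goods := fun i => Finset.univ.filter fun g => Sum.inl g ∈ A i
      frac := fun i => pieceFrac N (A i)
      goods_disjoint := fun i j hij => Finset.disjoint_left.2 fun g hg hg' =>
        Finset.disjoint_left.1 (hdis i j hij) (Finset.mem_filter.1 hg).2
          (Finset.mem_filter.1 hg').2
      frac_nonneg := fun i d => by unfold pieceFrac; positivity
      sum_frac_le_one := fun d => by
        simp only [pieceFrac]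
        rw [← Finset.sum_div, div_le_one hN, ← Nat.cast_sum, ← Finset.card_biUnion]
        · exact_mod_cast (Finset.card_le_univ _).trans (Fintype.card_fin N).le
        · exact fun i _ j _ hij => Finset.disjoint_left.2 fun g hg hg' =>
            Finset.disjoint_left.1 (hdis i j hij) (Finset.mem_filter.1 hg).2
              (Finset.mem_filter.1 hg').2 }
  have hA' : ∀ i j, I.utility i (A'.goods j) (A'.frac j) = ∑ h ∈ A j, I.cutUtility N i h :=
    fun i j => (I.sum_cutUtility N i (A j)).symm
  refine ⟨A', fun i j g hg => ?_, fun i j hj => ?_, fun B => ?_⟩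
  · rw [hA', ← Finset.erase_eq]
    have hg' : Sum.inl g ∈ A j := (Finset.mem_filter.1 hg).2
    refine le_trans (le_of_eq ?_) (hefx i j _ hg')
    rw [sum_cutUtility]
    congr 1
    · ext g'
      simp [A']
    · ext d
      simp [A', pieceFrac]
  · obtain ⟨d, hd⟩ := Function.ne_iff.1 hj
    obtain ⟨p, hp⟩ : ∃ p : Fin N, Sum.inr (d, p) ∈ A j := by
      by_contra! h
      exact hd (by simp [A', pieceFrac, h])
    have h1 := hefx i j _ hp
    have h2 := Finset.add_sum_erase (A j) (I.cutUtility N i) hp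
    have h3 : I.cutUtility N i (Sum.inr (d, p)) ≤ 1 / N :=
      div_le_div_of_nonneg_right (hI.uDiv_le_one i d) hN.le
    rw [hA', hA']
    linarith
  · refine (I.welfare_le_sum_max a b (fun i g => ha g i) (fun i d => hb d i) B).trans ?_
    have e : I.welfare A' = ∑ i, ∑ h ∈ A i, I.cutUtility N i h :=
      Finset.sum_congr rfl fun i _ => hA' i i
    rw [e]
    refine le_trans (le_of_eq ?_) hw
    rw [Fintype.sum_sum_type, Fintype.sum_prod_type]
    congr 1
    refine Finset.sum_congr rfl fun d _ => ?_
    simp only [cutUtility, Sum.elim_inr, Finset.sum_const, Finset.card_univ, Fintype.card_fin,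
      nsmul_eq_mul]
    field_simp

/-- A limit, along a subsequence, of the allocations of ever finer cuts is EFXM: the error towards
a bundle vanishes if its limit has a divisible part, and otherwise only the indivisible goods of
the bundle remain. -/
theorem IsScaled.exists_efxm_welfare [NeZero n] {I : Instance n m k} (hI : I.IsScaled) :
    ∃ A, I.IsEFXM A ∧ ∀ B, I.welfare B ≤ 8 * √n * I.welfare A := by
  choose A h1 h2 h3 using fun N : ℕ => hI.exists_almost_efxm (N + 1)
  let F : Ultrafilter ℕ := Filter.hyperfilter ℕ
  have hF : (F : Filter ℕ) ≤ Filter.atTop := by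
    rw [← Nat.cofinite_eq_atTop]
    exact Filter.hyperfilter_le_cofinite
  -- along the ultrafilter the indivisible parts are constant and the fractions converge
  obtain ⟨S, hS⟩ : ∃ S, ∀ᶠ N in F, (A N).goods = S :=
    (Ultrafilter.eventually_exists_iff).1 (Filter.Eventually.of_forall fun N => ⟨_, rfl⟩)
  obtain ⟨x, -, hx⟩ := (isCompact_Icc (a := (0 : Fin n → Fin k → ℝ)) (b := 1)).ultrafilter_le_nhds
    (F.map fun N => (A N).frac) (by
      rw [Ultrafilter.coe_map, Filter.le_principal_iff]
      refine Filter.mem_map.2 (Filter.univ_mem' fun N => ?_)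
      refine ⟨fun i d => (A N).frac_nonneg i d, fun i d => ?_⟩
      exact (Finset.single_le_sum (fun j _ => (A N).frac_nonneg j d)
        (Finset.mem_univ i)).trans ((A N).sum_frac_le_one d))
  have hx : Filter.Tendsto (fun N => (A N).frac) F (nhds x) := hx
  have hut : ∀ i j T, Filter.Tendsto (fun N => I.utility i T ((A N).frac j)) F
      (nhds (I.utility i T (x j))) := by
    intro i j T
    have : Continuous fun y : Fin n → Fin k → ℝ => I.utility i T (y j) := by
      unfold utility; fun_prop
    exact (this.tendsto x).comp hx
  let B : Allocation n m k :=
    { goods := S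
      frac := x
      goods_disjoint := by
        obtain ⟨N, hN⟩ := hS.exists
        exact hN ▸ (A N).goods_disjoint
      frac_nonneg := fun i d => ge_of_tendsto' ((hx.apply_nhds i).apply_nhds d)
        fun N => (A N).frac_nonneg i d
      sum_frac_le_one := fun d => le_of_tendsto'
        (tendsto_finsetSum _ fun i _ => (hx.apply_nhds i).apply_nhds d)
        fun N => (A N).sum_frac_le_one d }
  refine ⟨B, fun i j => ⟨fun _ => Or.inr fun g hg => ?_, fun hj => ?_⟩, fun C => ?_⟩
  · refine le_of_tendsto_of_tendsto (hut i j _) (hut i i _) ?_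
    filter_upwards [hS] with N hN
    have := h1 N i j g (by rw [hN]; exact hg)
    rwa [hN] at this
  · have hlim : Filter.Tendsto (fun N : ℕ => I.utility i (S i) ((A N).frac i) + 1 / ((N : ℝ) + 1))
        F (nhds (I.utility i (S i) (x i) + 0)) :=
      (hut i i _).add (tendsto_one_div_add_atTop_nhds_zero_nat.mono_left hF)
    rw [add_zero] at hlim
    refine le_of_tendsto_of_tendsto (hut i j _) hlim ?_
    filter_upwards [hS, (hx.apply_nhds j).eventually_ne hj] with N hN hNj
    have := h2 N i j hNj
    rw [hN] at this
    exact_mod_cast this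
  · have hlim : Filter.Tendsto (fun N => 8 * √n * ∑ i, I.utility i (S i) ((A N).frac i)) F
        (nhds (8 * √n * ∑ i, I.utility i (S i) (x i))) :=
      (tendsto_finsetSum _ fun i _ => hut i i _).const_mul _
    refine ge_of_tendsto hlim ?_
    filter_upwards [hS] with N hN
    have := h3 N C
    rwa [welfare, welfare, hN] at this

/-! ### Prices from welfare bounds -/

theorem price_le_of_welfare_le {I : Instance n m k} {P : Allocation n m k → Prop}
    (hP : IsGreatest (I.welfare '' {A | P A}) (I.maxWelfare P)) {c : ℝ} (hc : 0 ≤ c)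
    {A : Allocation n m k} (hA : P A) (h : ∀ B, I.welfare B ≤ c * I.welfare A) :
    I.price P ≤ ENNReal.ofReal c := by
  refine ENNReal.div_le_of_le_mul ?_
  rw [← ENNReal.ofReal_mul hc]
  refine ENNReal.ofReal_le_ofReal ?_
  obtain ⟨B, hB⟩ := I.isGreatest_maxWelfare_true.1
  rw [← hB]
  exact (h B).trans (mul_le_mul_of_nonneg_left (hP.2 ⟨A, hA, rfl⟩) hc)

theorem le_price_of_le_welfare {I : Instance n m k} {P : Allocation n m k → Prop}
    (hP : IsGreatest (I.welfare '' {A | P A}) (I.maxWelfare P)) {c w : ℝ} (hw : 0 < w)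
    (A : Allocation n m k) (hA : c * w ≤ I.welfare A) (h : ∀ B, P B → I.welfare B ≤ w) :
    ENNReal.ofReal c ≤ I.price P := by
  have h1 : c * w ≤ I.opt := hA.trans (I.isGreatest_maxWelfare_true.2 ⟨A, rfl⟩)
  have h2 : I.maxWelfare P ≤ w := by
    obtain ⟨B, hB, e⟩ := hP.1
    exact e ▸ h B hB
  have e : ENNReal.ofReal c = ENNReal.ofReal (c * w) / ENNReal.ofReal w := by
    rw [← ENNReal.ofReal_div_of_pos hw, mul_div_cancel_right₀ _ hw.ne']
  rw [e]
  exact ENNReal.div_le_div (ENNReal.ofReal_le_ofReal h1) (ENNReal.ofReal_le_ofReal h2)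

/-! ### The lower bound -/

/-- An instance of high price with `r` divisible goods and no indivisible one: each of the first
`r` agents values only the good of the same index, and all others value all goods equally. -/
noncomputable def hard (n r : ℕ) : Instance n 0 r where
  uInd _ _ := 0
  uDiv i d := if i.val < r then (if i.val = d.val then 1 else 0) else 1 / r
  uInd_nonneg _ _ := le_rfl
  uDiv_nonneg i d := by split_ifs <;> positivity

theorem sum_ite_val_eq {n r : ℕ} (i : Fin n) (hi : i.val < r) (f : Fin r → ℝ) :
    ∑ d, f d * (if i.val = d.val then 1 else 0) = f ⟨i, hi⟩ := by
  rw [Finset.sum_eq_single ⟨i, hi⟩]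
  · simp
  · intro d _ hd
    rw [if_neg fun h => hd (Fin.ext h.symm), mul_zero]
  · simp

theorem utility_hard_of_lt {n r : ℕ} {i : Fin n} (hi : i.val < r) (S : Finset (Fin 0))
    (x : Fin r → ℝ) : (hard n r).utility i S x = x ⟨i, hi⟩ := by
  simp only [utility, hard, Finset.sum_const_zero, zero_add, if_pos hi]
  exact sum_ite_val_eq i hi x

theorem utility_hard_of_ge {n r : ℕ} {i : Fin n} (hi : r ≤ i.val) (S : Finset (Fin 0))
    (x : Fin r → ℝ) : (hard n r).utility i S x = (∑ d, x d) / r := by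
  simp only [utility, hard, Finset.sum_const_zero, zero_add, if_neg hi.not_gt]
  rw [← Finset.sum_mul, mul_one_div]

theorem isScaled_hard {n r : ℕ} (hr : 0 < r) : (hard n r).IsScaled := by
  intro i
  rcases lt_or_ge i.val r with hi | hi
  · rw [utility_hard_of_lt hi]
  · have : (r : ℝ) ≠ 0 := by positivity
    rw [utility_hard_of_ge hi]
    simp [this]

theorem card_filter_val_lt {n r : ℕ} (h : r ≤ n) :
    (Finset.univ.filter fun i : Fin n => i.val < r).card = r := by
  simpa [h] using Fin.card_filter_val_lt (n := n) (m := r)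

/-- Giving good `i` to agent `i` for all `i < r`. -/
theorem exists_welfare_hard {n r : ℕ} (h : r ≤ n) :
    ∃ A, (r : ℝ) ≤ (hard n r).welfare A := by
  let A : Allocation n 0 r :=
    { goods := fun _ => ∅
      frac := fun i d => if i.val = d.val then 1 else 0
      goods_disjoint := fun _ _ _ => Finset.disjoint_empty_left _
      frac_nonneg := fun i d => by split_ifs <;> positivity
      sum_frac_le_one := fun d => by
        rw [Finset.sum_eq_single ⟨d, d.2.trans_le h⟩]
        · simp
        · exact fun i _ hi => if_neg fun e => hi (Fin.ext e)
        · simp }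
  refine ⟨A, ?_⟩
  calc (r : ℝ) = ∑ i : Fin n, if i.val < r then (1 : ℝ) else 0 := by
        rw [Finset.sum_boole, card_filter_val_lt h]
    _ ≤ _ := Finset.sum_le_sum fun i _ => by
        split_ifs with hi
        · rw [utility_hard_of_lt hi]; simp [A]
        · rw [utility_hard_of_ge (not_lt.1 hi)]
          exact div_nonneg (Finset.sum_nonneg fun d _ => A.frac_nonneg i d) (by positivity)

/-- The agents with equal values bound the total fraction that any single agent can hold without
being envied. -/
theorem welfare_hard_le {n r : ℕ} (hr : 0 < r) (hrn : r ≤ n)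
    (h : r = 1 ∨ r * r ≤ 2 * (n - r)) {A : Allocation n 0 r} (hA : (hard n r).IsEFM A) :
    (hard n r).welfare A ≤ 3 := by
  have hr0 : (0 : ℝ) < r := by exact_mod_cast hr
  have hef : ∀ i j, (hard n r).utility i (A.goods j) (A.frac j) ≤
      (hard n r).utility i (A.goods i) (A.frac i) := by
    intro i j
    by_cases hj : A.frac j = 0
    · exact ((hA i j).1 hj).elim id fun ⟨g, _⟩ => g.elim0
    · exact (hA i j).2 hj
  set s : Fin n → ℝ := fun i => ∑ d, A.frac i d with hs
  have hs0 : ∀ i, 0 ≤ s i := fun i => Finset.sum_nonneg fun d _ => A.frac_nonneg i d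
  have hsum : ∑ i, s i ≤ r := by
    rw [hs, Finset.sum_comm]
    calc _ ≤ ∑ _d : Fin r, (1 : ℝ) := Finset.sum_le_sum fun d _ => A.sum_frac_le_one d
      _ = r := by simp
  have hle : ∀ i j : Fin n, r ≤ j.val → s i ≤ s j := by
    intro i j hj
    have := hef j i
    rw [utility_hard_of_ge hj, utility_hard_of_ge hj] at this
    exact (div_le_div_iff_of_pos_right hr0).1 this
  have hsub : ∀ T : Finset (Fin n), ∑ i ∈ T, s i ≤ r := fun T =>
    (Finset.sum_le_sum_of_subset_of_nonneg (Finset.subset_univ T) fun i _ _ => hs0 i).trans hsum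
  have hlow : ∑ i with i.val < r, s i ≤ 2 := by
    rcases h with rfl | h
    -- a single good, so all fractions together are at most `1`
    · exact (hsub _).trans (by norm_num)
    have hcard : (Finset.univ.filter fun i : Fin n => ¬ i.val < r).card = n - r := by
      have := Finset.card_filter_add_card_filter_not (s := (Finset.univ : Finset (Fin n)))
        (fun i => i.val < r)
      rw [card_filter_val_lt hrn, Finset.card_univ, Fintype.card_fin] at this
      omega
    have h1 : ∀ i, ((n - r : ℕ) : ℝ) * s i ≤ r := fun i => by
      calc ((n - r : ℕ) : ℝ) * s i = ∑ j : Fin n with ¬ j.val < r, s i := by simp [← hcard]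
        _ ≤ ∑ j : Fin n with ¬ j.val < r, s j := Finset.sum_le_sum fun j hj =>
            hle i j (not_lt.1 (Finset.mem_filter.1 hj).2)
        _ ≤ r := hsub _
    have h2 : ((n - r : ℕ) : ℝ) * ∑ i with i.val < r, s i ≤ r * r := by
      rw [Finset.mul_sum]
      calc _ ≤ ∑ i : Fin n with i.val < r, (r : ℝ) := Finset.sum_le_sum fun i _ => h1 i
        _ = r * r := by simp [card_filter_val_lt hrn]
    have h3 : (r : ℝ) * r ≤ 2 * ((n - r : ℕ) : ℝ) := by exact_mod_cast h
    have h4 : (0 : ℝ) < ((n - r : ℕ) : ℝ) := by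
      have : (0 : ℝ) < r * r := by positivity
      linarith
    refine le_of_mul_le_mul_left (h2.trans (h3.trans_eq (mul_comm _ _))) h4
  have hhigh : ∑ i with ¬ i.val < r, s i / r ≤ 1 := by
    rw [← Finset.sum_div, div_le_one hr0]
    exact hsub _
  rw [welfare, ← Finset.sum_filter_add_sum_filter_not _ (fun i : Fin n => i.val < r)]
  have e1 : ∑ i : Fin n with i.val < r, (hard n r).utility i (A.goods i) (A.frac i) ≤
      ∑ i with i.val < r, s i := Finset.sum_le_sum fun i hi => by
    rw [utility_hard_of_lt (Finset.mem_filter.1 hi).2]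
    exact Finset.single_le_sum (f := A.frac i) (fun d _ => A.frac_nonneg i d) (Finset.mem_univ _)
  have e2 : ∑ i : Fin n with ¬ i.val < r, (hard n r).utility i (A.goods i) (A.frac i) =
      ∑ i with ¬ i.val < r, s i / r := Finset.sum_congr rfl fun i hi => by
    rw [utility_hard_of_ge (not_lt.1 (Finset.mem_filter.1 hi).2)]
  linarith

/-- A criterion that implies EFM has price at least `√n / 6`. -/
theorem le_scaledPrice (P : ∀ {n m k : ℕ}, Instance n m k → Allocation n m k → Prop)
    (hP : ∀ {n m k : ℕ} (I : Instance n m k),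
      IsGreatest (I.welfare '' {A | P I A}) (I.maxWelfare (P I)))
    (hEFM : ∀ {n m k : ℕ} {I : Instance n m k} {A : Allocation n m k}, P I A → I.IsEFM A)
    {n : ℕ} (hn : 1 ≤ n) : ENNReal.ofReal (1 / 6 * √n) ≤ scaledPrice P n := by
  set r := Nat.sqrt n with hrdef
  have hr : 0 < r := Nat.sqrt_pos.2 hn
  have hrn : r * r ≤ n := Nat.sqrt_le n
  have hnr : n < (r + 1) * (r + 1) := Nat.lt_succ_sqrt n
  have hcase : r = 1 ∨ r * r ≤ 2 * (n - r) := by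
    rcases (Nat.succ_le_of_lt hr).eq_or_lt with h | h
    · exact Or.inl h.symm
    · right
      have : 2 * r ≤ r * r := Nat.mul_le_mul_right r h
      omega
  have hrn' : r ≤ n := Nat.sqrt_le_self n
  obtain ⟨A, hA⟩ := exists_welfare_hard hrn'
  have hsqrt : √(n : ℝ) ≤ 2 * r := by
    rw [Real.sqrt_le_left (by positivity)]
    have h1 : (n : ℝ) < (r + 1) * (r + 1) := by exact_mod_cast hnr
    have h2 : (1 : ℝ) ≤ r := by exact_mod_cast hr
    nlinarith
  refine le_trans (le_price_of_le_welfare (hP (hard n r)) three_pos A (by linarith)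
    fun B hB => welfare_hard_le hr hrn' hcase (hEFM hB)) ?_
  exact le_iSup_of_le 0 (le_iSup_of_le r (le_iSup₂_of_le (hard n r) (isScaled_hard hr) le_rfl))

/-! ### The upper bound -/

/-- A criterion that EFXM implies has price at most `8 √n`. -/
theorem scaledPrice_le (P : ∀ {n m k : ℕ}, Instance n m k → Allocation n m k → Prop)
    (hP : ∀ {n m k : ℕ} (I : Instance n m k),
      IsGreatest (I.welfare '' {A | P I A}) (I.maxWelfare (P I)))
    (hEFXM : ∀ {n m k : ℕ} {I : Instance n m k} {A : Allocation n m k}, I.IsEFXM A → P I A)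
    {n : ℕ} (hn : 1 ≤ n) : scaledPrice P n ≤ ENNReal.ofReal (8 * √n) := by
  have : NeZero n := ⟨by omega⟩
  refine iSup₂_le fun m k => iSup₂_le fun I hI => ?_
  obtain ⟨A, hA, h⟩ := hI.exists_efxm_welfare
  exact price_le_of_welfare_le (hP I) (by positivity) (hEFXM hA) h

end Instance

end MixedGoods

theorem mainTheorem4 :
    (∃ c C : ℝ, 0 < c ∧ 0 < C ∧ ∀ n : ℕ, 1 ≤ n →
      ENNReal.ofReal (c * Real.sqrt n) ≤ MixedGoods.scaledPrice MixedGoods.Instance.IsEFM n ∧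
      MixedGoods.scaledPrice MixedGoods.Instance.IsEFM n ≤ ENNReal.ofReal (C * Real.sqrt n)) ∧
    (∃ c C : ℝ, 0 < c ∧ 0 < C ∧ ∀ n : ℕ, 1 ≤ n →
      ENNReal.ofReal (c * Real.sqrt n) ≤ MixedGoods.scaledPrice MixedGoods.Instance.IsEFXM n ∧
      MixedGoods.scaledPrice MixedGoods.Instance.IsEFXM n ≤ ENNReal.ofReal (C * Real.sqrt n)) := by
  open MixedGoods.Instance in
  exact ⟨⟨1 / 6, 8, by norm_num, by norm_num, fun n hn =>
      ⟨le_scaledPrice IsEFM isGreatest_maxWelfare_isEFM id hn,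
        scaledPrice_le IsEFM isGreatest_maxWelfare_isEFM IsEFXM.isEFM hn⟩⟩,
    ⟨1 / 6, 8, by norm_num, by norm_num, fun n hn =>
      ⟨le_scaledPrice IsEFXM isGreatest_maxWelfare_isEFXM IsEFXM.isEFM hn,
        scaledPrice_le IsEFXM isGreatest_maxWelfare_isEFXM id hn⟩⟩⟩
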